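/- Let $n\ge 1$. "Cube" means a cube in $\mathbb R^n$ with sides parallel to the axes and positive side length, $|E|$ is Lebesgue measure, and $h_Q=\frac1{|Q|}\int_Q h$. For a cube $Q$ let $\mathcal D(Q)$ be the family of its dyadic descendants ($Q$ included), and let $$M_Qh(x)=\sup_{x\in R\in\mathcal D(Q)}\frac1{|R|}\int_R|h|,\qquad M^\sharp h(x)=\sup_{R\ni x}\frac1{|R|}\int_R|h-h_R|,\qquad Mh(x)=\sup_{R\ni x}\frac1{|R|}\int_R|h|,$$ where the last two suprema run over all cubes $R$ containing $x$. A weight is a non-negative locally integrable function $w$ on $\mathbb R^n$. For a weight $w$, a cube $Q$ and $1<r<\infty$, put $$w(Q)=\int_Q w,\qquad w_r(Q)=|Q|\Big(\frac1{|Q|}\int_Q w^r\Big)^{1/r}\in[0,\infty],\qquad r'=\frac r{r-1}.$$ Let $[w]_{A_1}=\operatorname{ess\,sup}_x \frac{Mw(x)}{w(x)}$ and, for $1<p<\infty$, $[w]_{A_p}=\sup_Q\big(\frac1{|Q|}\int_Qw\big)\big(\frac1{|Q|}\int_Qw^{1-p'}\big)^{p-1}$; let $A_\infty$ be the class of weights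 with $[w]_{A_p}<\infty$ for some $1\le p<\infty$, and $$[w]_{A_\infty}=\sup_Q\frac1{w(Q)}\int_Q M(w\mathbf 1_Q)\,dx .$$ **Theorem 1.1.** There is a constant $c_n>0$ depending only on $n$ such that for every locally integrable $f:\mathbb R^n\to\mathbb R$, every weight $w$, every cube $Q$ and every $1\le p<\infty$ the following holds. For every $1<r<\infty$, $$\left(\frac1{w_r(Q)}\int_Q\left(\frac{M_Q(f-f_Q)(x)}{M^\sharp f(x)}\right)^pw(x)\,dx\right)^{1/p}\le c_n\,p\,r'.$$ If, further, $w\in A_\infty$, then $$\left(\frac1{w(Q)}\int_Q\left(\frac{M_Q(f-f_Q)(x)}{M^\sharp f(x)}\right)^pw(x)\,dx\right)^{1/p}\le c_n\,p\,[w]_{A_\infty}.$$ (Quotients are taken in $[0,\infty]$ with $0/0=0$, $a/0=\infty$ for $a>0$, and $a/\infty=0$.) -/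

import Mathlib

open MeasureTheory
open scoped ENNReal

noncomputable section

namespace SharpJN

/-- A cube in `ℝⁿ` with sides parallel to the coordinate axes, given by its lower corner and
its (positive) side length. -/
structure Cube (n : ℕ) where
  corner : Fin n → ℝ
  side : ℝ
  side_pos : 0 < side

/-- The set of points of the (half-open) cube `∏ᵢ [aᵢ, aᵢ + ℓ)`. -/
def Cube.toSet {n : ℕ} (Q : Cube n) : Set (Fin n → ℝ) :=
  Set.univ.pi fun i => Set.Ico (Q.corner i) (Q.corner i + Q.side)

instance {n : ℕ} : Coe (Cube n) (Set (Fin n → ℝ)) := ⟨Cube.toSet⟩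

/-- The dyadic descendant of `Q` of generation `m` and position `k ∈ {0, …, 2 ^ m - 1}ⁿ`. -/
def Cube.descendant {n : ℕ} (Q : Cube n) (m : ℕ) (k : Fin n → Fin (2 ^ m)) : Cube n where
  corner := fun i => Q.corner i + ((k i : ℕ) : ℝ) * (Q.side / 2 ^ m)
  side := Q.side / 2 ^ m
  side_pos := div_pos Q.side_pos (by positivity)

/-- The family `𝒟(Q)` of all dyadic descendants of `Q` (including `Q` itself). -/
def Cube.dyadic {n : ℕ} (Q : Cube n) : Set (Cube n) :=
  {R | ∃ (m : ℕ) (k : Fin n → Fin (2 ^ m)), R = Q.descendant m k}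

/-- The average `h_Q` of `h` over the cube `Q`. -/
def avg {n : ℕ} (h : (Fin n → ℝ) → ℝ) (Q : Cube n) : ℝ :=
  ⨍ y in (Q : Set (Fin n → ℝ)), h y

/-- The average `⨍_Q g = |Q|⁻¹ ∫_Q g` of a function `g` with values in `[0, ∞]`. -/
def lavg {n : ℕ} (g : (Fin n → ℝ) → ℝ≥0∞) (Q : Cube n) : ℝ≥0∞ :=
  (∫⁻ y in (Q : Set (Fin n → ℝ)), g y) / volume (Q : Set (Fin n → ℝ))

/-- The mean oscillation `⨍_Q |h - h_Q|`, with values in `[0, ∞]`. -/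
def osc {n : ℕ} (h : (Fin n → ℝ) → ℝ) (Q : Cube n) : ℝ≥0∞ :=
  lavg (fun y => ‖h y - avg h Q‖ₑ) Q

/-- The Fefferman–Stein sharp maximal function
`M^♯ h (x) = sup_{R ∋ x} ⨍_R |h - h_R|`, over all cubes `R` that contain `x`. -/
def sharpMaximal {n : ℕ} (h : (Fin n → ℝ) → ℝ) (x : Fin n → ℝ) : ℝ≥0∞ :=
  ⨆ (R : Cube n) (_ : x ∈ (R : Set (Fin n → ℝ))), osc h R

/-- The local dyadic maximal operator
`M_Q h (x) = sup_{x ∈ R ∈ 𝒟(Q)} ⨍_R |h|`. -/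
def localDyadicMaximal {n : ℕ} (Q : Cube n) (h : (Fin n → ℝ) → ℝ) (x : Fin n → ℝ) : ℝ≥0∞ :=
  ⨆ (R : Cube n) (_ : R ∈ Q.dyadic) (_ : x ∈ (R : Set (Fin n → ℝ))),
    lavg (fun y => ‖h y‖ₑ) R

/-- The Hardy–Littlewood maximal operator `M h (x) = sup_{R ∋ x} ⨍_R |h|`, over all cubes `R`
that contain `x`. -/
def maximal {n : ℕ} (h : (Fin n → ℝ) → ℝ) (x : Fin n → ℝ) : ℝ≥0∞ :=
  ⨆ (R : Cube n) (_ : x ∈ (R : Set (Fin n → ℝ))), lavg (fun y => ‖h y‖ₑ) R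

/-- A weight is a non-negative locally integrable function on `ℝⁿ`. -/
structure IsWeight {n : ℕ} (w : (Fin n → ℝ) → ℝ) : Prop where
  nonneg : ∀ x, 0 ≤ w x
  locallyIntegrable : LocallyIntegrable w volume

/-- `w(Q) = ∫_Q w`. -/
def mass {n : ℕ} (w : (Fin n → ℝ) → ℝ) (Q : Cube n) : ℝ≥0∞ :=
  ∫⁻ x in (Q : Set (Fin n → ℝ)), ENNReal.ofReal (w x)

/-- `w_r(Q) = |Q| (⨍_Q w ^ r) ^ (1 / r)`. It is `∞` when `w ^ r` is not integrable over `Q`. -/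
def massR {n : ℕ} (r : ℝ) (w : (Fin n → ℝ) → ℝ) (Q : Cube n) : ℝ≥0∞ :=
  volume (Q : Set (Fin n → ℝ)) *
    lavg (fun x => ENNReal.ofReal (w x) ^ r) Q ^ (1 / r)

/-- The constant `[w]_{A_1} = ess sup M w / w`. -/
def aOneConst {n : ℕ} (w : (Fin n → ℝ) → ℝ) : ℝ≥0∞ :=
  essSup (fun x => maximal w x / ENNReal.ofReal (w x)) volume

/-- The constant `[w]_{A_p} = sup_Q (⨍_Q w) (⨍_Q w ^ (1 - p')) ^ (p - 1)`, for `1 < p < ∞`.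
The negative power is taken in `[0, ∞]`, so it is `∞` where `w` vanishes. -/
def aPConst {n : ℕ} (p : ℝ) (w : (Fin n → ℝ) → ℝ) : ℝ≥0∞ :=
  ⨆ Q : Cube n, lavg (fun x => ENNReal.ofReal (w x)) Q *
    lavg (fun x => ENNReal.ofReal (w x) ^ (1 - Real.conjExponent p)) Q ^ (p - 1)

/-- Membership of a weight in `A_∞ = ⋃_{1 ≤ p < ∞} A_p`. -/
def MemAInfty {n : ℕ} (w : (Fin n → ℝ) → ℝ) : Prop :=
  aOneConst w < ∞ ∨ ∃ p : ℝ, 1 < p ∧ aPConst p w < ∞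

/-- The (Fujii–Wilson) constant `[w]_{A_∞} = sup_Q (∫_Q M(w 1_Q)) / w(Q)`. -/
def aInftyConst {n : ℕ} (w : (Fin n → ℝ) → ℝ) : ℝ≥0∞ :=
  ⨆ Q : Cube n,
    (∫⁻ x in (Q : Set (Fin n → ℝ)), maximal (Set.indicator (Q : Set (Fin n → ℝ)) w) x) / mass w Q

/-- The quantity `∫_Q (M_Q(f - f_Q) / M^♯ f) ^ p w dx`. -/
def ratioIntegral {n : ℕ} (f w : (Fin n → ℝ) → ℝ) (Q : Cube n) (p : ℝ) : ℝ≥0∞ :=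
  ∫⁻ x in (Q : Set (Fin n → ℝ)),
    (localDyadicMaximal Q (fun y => f y - avg f Q) x / sharpMaximal f x) ^ p *
      ENNReal.ofReal (w x)

end SharpJN

end

/-! For each cube `R` select the maximal dyadic descendants on which the average of `|f - f_R|`
exceeds twice the oscillation of `f` on `R`. By Chebyshev they fill at most half of `R`. Iterating
the selection from `Q` gives a tree; let `N x` be the number of its generations that cover `x`. Each
generation changes the subtracted mean by at most `2 ^ (n + 1) * M^♯ f x`, so `M_Q (f - f_Q) ≤ 2 ^
(n + 1) * M^♯ f * N` pointwise (`localDyadicMaximal_le`), and only moments of `N` remain.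

If at every node the generations have total `μ`-mass at most `Λ` times that of the node, then the
`L^q(μ)` norm of `N` is at most `2qΛ μ(Q)^(1/q)` (`IsTree.lintegral_layerCount_rpow_le`). Lebesgue
measure has `Λ = 2`, and Hölder with `q = p r'` gives the first bound. The measure `w dx` has `Λ = 2
[w]_{A_∞}` (`IsWeight.tsum_layer_le`), and `q = p` gives the second. -/

namespace SharpJN

/-! ### Trees of sets: Carleson packing and moments of the counting function. -/

section Tree

variable {α ι : Type*}

/-- The union of the `j`-th generation of descendants of a node in a tree of sets. -/
def layer (S : ι → Set α) (ch : ι → Set ι) : ℕ → ι → Set α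
  | 0, R => S R
  | j + 1, R => ⋃ P ∈ ch R, layer S ch j P

/-- The number of generations of the tree that cover a given point. -/
noncomputable def layerCount (S : ι → Set α) (ch : ι → Set ι) (R : ι) (x : α) : ℝ≥0∞ :=
  ∑' j, (layer S ch j R).indicator 1 x

/-- A tree of measurable sets in which the children of a node are countably many disjoint
subsets of the node. -/
structure IsTree [MeasurableSpace α] (S : ι → Set α) (ch : ι → Set ι) : Prop where
  measurable : ∀ R, MeasurableSet (S R)
  countable : ∀ R, (ch R).Countable
  subset : ∀ R, ∀ R' ∈ ch R, S R' ⊆ S R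
  disjoint : ∀ R, (ch R).PairwiseDisjoint S

/-- The hockey-stick identity turns the sum with binomials of order `k + 1` into one of order `k`
over tails of `a`; bounding each tail costs one factor `Λ`. -/
lemma tsum_choose_mul_le {a : ℕ → ℝ≥0∞} {Λ : ℝ≥0∞} (ha : ∀ j, ∑' i, a (i + j) ≤ Λ * a j)
    (k j : ℕ) : ∑' i, ((i + k).choose k : ℝ≥0∞) * a (i + j) ≤ Λ ^ (k + 1) * a j := by
  induction k with
  | zero => simpa using ha j
  | succ k ih =>
    have hchoose (i : ℕ) : ((i + (k + 1)).choose (k + 1) : ℝ≥0∞) =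
        ∑ q ∈ Finset.HasAntidiagonal.antidiagonal i, ((q.2 + k).choose k : ℝ≥0∞) := by
      rw [Finset.Nat.sum_antidiagonal_eq_sum_range_succ_mk, ← add_assoc,
        ← Nat.sum_range_add_choose]
      push_cast
      exact (Finset.sum_range_reflect (fun l => ((l + k).choose k : ℝ≥0∞)) (i + 1)).symm
    calc ∑' i, ((i + (k + 1)).choose (k + 1) : ℝ≥0∞) * a (i + j)
        = ∑' i, ∑ q ∈ Finset.HasAntidiagonal.antidiagonal i, ((q.2 + k).choose k : ℝ≥0∞) * a (q.1 + (q.2 + j)) := by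
          refine tsum_congr fun i => ?_
          rw [hchoose, Finset.sum_mul]
          refine Finset.sum_congr rfl fun q hq => ?_
          rw [← Finset.HasAntidiagonal.mem_antidiagonal.1 hq, add_assoc]
      _ = ∑' q : ℕ × ℕ, ((q.2 + k).choose k : ℝ≥0∞) * a (q.1 + (q.2 + j)) := by
          rw [← Finset.HasAntidiagonal.sigmaAntidiagonalEquivProd.tsum_eq, ENNReal.tsum_sigma']
          refine tsum_congr fun i => ?_
          rw [tsum_fintype, ← Finset.sum_coe_sort]
          rfl
      _ = ∑' l, ((l + k).choose k : ℝ≥0∞) * ∑' i, a (i + (l + j)) := by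
          rw [ENNReal.tsum_prod (f := fun i l : ℕ => ((l + k).choose k : ℝ≥0∞) * a (i + (l + j))),
            ENNReal.tsum_comm]
          simp_rw [ENNReal.tsum_mul_left]
      _ ≤ ∑' l, Λ * (((l + k).choose k : ℝ≥0∞) * a (l + j)) := by
          refine ENNReal.tsum_le_tsum fun l => ?_
          rw [mul_left_comm]
          gcongr
          exact ha _
      _ ≤ Λ ^ (k + 1 + 1) * a j := by
          rw [ENNReal.tsum_mul_left, pow_succ' Λ (k + 1), mul_assoc]
          gcongr

/-- If `x` lies in exactly the first `m` sets, this is `m ^ (k + 1) ≤ m (m + 1) ⋯ (m + k)`, the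
right side being `(k + 1)!` times a hockey-stick sum. If `x` lies in all of them, the right side is
infinite. -/
lemma pow_sum_indicator_le {s : ℕ → Set α} (hs : Antitone s) (k : ℕ) (x : α) :
    (∑' j, (s j).indicator (1 : α → ℝ≥0∞) x) ^ (k + 1) ≤
      ((k + 1).factorial : ℝ≥0∞) *
        ∑' j, ((j + k).choose k : ℝ≥0∞) * (s j).indicator (1 : α → ℝ≥0∞) x := by
  classical
  by_cases hx : ∀ j, x ∈ s j
  · have : ∑' j, ((j + k).choose k : ℝ≥0∞) * (s j).indicator (1 : α → ℝ≥0∞) x = ∞ := by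
      refine top_unique ((ENNReal.tsum_const_eq_top_of_ne_zero (α := ℕ) one_ne_zero).symm.le.trans
        (ENNReal.tsum_le_tsum fun j => ?_))
      rw [Set.indicator_of_mem (hx j), Pi.one_apply, mul_one]
      exact_mod_cast Nat.choose_pos (Nat.le_add_left k j)
    rw [this, ENNReal.mul_top (by exact_mod_cast Nat.factorial_ne_zero _)]
    exact le_top
  · push Not at hx
    obtain ⟨m, hm⟩ : ∃ m, ∀ j, x ∈ s j ↔ j < m := by
      refine ⟨Nat.find hx, fun j => ⟨fun h => ?_, fun h => not_not.1 (Nat.find_min hx h)⟩⟩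
      by_contra! hle
      exact Nat.find_spec hx (hs hle h)
    have hsum (c : ℕ → ℝ≥0∞) :
        ∑' j, c j * (s j).indicator (1 : α → ℝ≥0∞) x = ∑ j ∈ Finset.range m, c j := by
      rw [tsum_eq_sum (s := Finset.range m)]
      · refine Finset.sum_congr rfl fun j hj => ?_
        rw [Set.indicator_of_mem ((hm j).2 (Finset.mem_range.1 hj)), Pi.one_apply, mul_one]
      · intro j hj
        rw [Set.indicator_of_notMem (fun h => hj (Finset.mem_range.2 ((hm j).1 h))), mul_zero]
    have h1 := hsum 1
    simp only [Pi.one_apply, one_mul, Finset.sum_const, Finset.card_range, nsmul_eq_mul,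
      mul_one] at h1
    rw [hsum, h1]
    have h2 : m ^ (k + 1) ≤ (k + 1).factorial * ∑ j ∈ Finset.range m, (j + k).choose k := by
      rcases m with _ | m
      · simp
      · rw [Nat.sum_range_add_choose, show m + k + 1 = m + 1 + (k + 1) - 1 by omega,
          ← Nat.ascFactorial_eq_factorial_mul_choose']
        exact Nat.pow_succ_le_ascFactorial _ _
    exact_mod_cast h2

variable [MeasurableSpace α] {S : ι → Set α} {ch : ι → Set ι}

namespace IsTree

lemma measurableSet_layer (h : IsTree S ch) (j : ℕ) (R : ι) : MeasurableSet (layer S ch j R) := by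
  induction j generalizing R with
  | zero => exact h.measurable R
  | succ j ih => exact MeasurableSet.biUnion (h.countable R) fun R' _ => ih R'

lemma layer_succ_subset (h : IsTree S ch) (j : ℕ) (R : ι) :
    layer S ch (j + 1) R ⊆ layer S ch j R := by
  induction j generalizing R with
  | zero => exact Set.iUnion₂_subset fun R' hR' => h.subset R R' hR'
  | succ j ih => exact Set.iUnion₂_mono fun R' _ => ih R'

lemma layer_antitone (h : IsTree S ch) (R : ι) : Antitone fun j => layer S ch j R :=
  antitone_nat_of_succ_le fun j => h.layer_succ_subset j R

lemma layer_subset (h : IsTree S ch) (j : ℕ) (R : ι) : layer S ch j R ⊆ S R :=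
  h.layer_antitone R (Nat.zero_le j)

lemma measure_layer_succ (h : IsTree S ch) (μ : Measure α) (j : ℕ) (R : ι) :
    μ (layer S ch (j + 1) R) = ∑' R' : ch R, μ (layer S ch j R') :=
  measure_biUnion (h.countable R)
    ((h.disjoint R).mono_on fun R' _ => h.layer_subset j R')
    fun R' _ => h.measurableSet_layer j R'

/-- Siblings are disjoint, so a point of the child `R'` can be in a deeper layer of `R` only through
`R'` itself. Hence the shells of the children are disjoint pieces of a shell of `R`. -/
lemma measure_layer_diff_succ (h : IsTree S ch) (μ : Measure α) (j : ℕ) (R : ι) :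
    ∑' R' : ch R, μ (layer S ch j R' \ layer S ch (j + 1) R') ≤
      μ (layer S ch (j + 1) R \ layer S ch (j + 2) R) := by
  rw [← measure_biUnion (h.countable R)
    ((h.disjoint R).mono_on fun R' _ => Set.sdiff_subset.trans (h.layer_subset j R'))
    fun R' _ => (h.measurableSet_layer j R').diff (h.measurableSet_layer (j + 1) R')]
  refine measure_mono (Set.iUnion₂_subset fun R' hR' x hx => ⟨?_, fun hx2 => ?_⟩)
  · exact Set.mem_biUnion hR' hx.1
  · obtain ⟨R'', hR'', hx''⟩ := Set.mem_iUnion₂.1 hx2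
    have heq : R'' = R' := (h.disjoint R).elim_set hR'' hR' x (h.layer_subset _ _ hx'')
      (h.layer_subset _ _ hx.1)
    exact hx.2 (heq ▸ hx'')

/-- The set `T` confines the hypothesis to nodes inside a fixed root, so that `ν` may depend on that
root. -/
lemma measure_layer_le (h : IsTree S ch) {μ ν : Measure α} {T : Set α}
    (hμν : ∀ R, S R ⊆ T → μ (S R) ≤ ν (S R \ layer S ch 1 R)) (j : ℕ) (R : ι) (hR : S R ⊆ T) :
    μ (layer S ch j R) ≤ ν (layer S ch j R \ layer S ch (j + 1) R) := by
  induction j generalizing R with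
  | zero => exact hμν R hR
  | succ j ih =>
    rw [h.measure_layer_succ]
    exact (ENNReal.tsum_le_tsum fun R' : ch R => ih R'.1 ((h.subset R R'.1 R'.2).trans hR)).trans
      (h.measure_layer_diff_succ ν j R)

/-- A measure that is controlled on each node by the part of a second measure that is left
after the removal of the children satisfies a Carleson packing condition. -/
lemma tsum_measure_layer_le (h : IsTree S ch) {μ ν : Measure α} (R : ι)
    (hμν : ∀ R', S R' ⊆ S R → μ (S R') ≤ ν (S R' \ layer S ch 1 R')) :
    ∑' j, μ (layer S ch j R) ≤ ν (S R) := by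
  refine (ENNReal.tsum_le_tsum fun j => h.measure_layer_le hμν j R subset_rfl).trans ?_
  rw [← measure_iUnion]
  · exact measure_mono (Set.iUnion_subset fun j => Set.sdiff_subset.trans (h.layer_subset j R))
  · refine (pairwise_disjoint_on _).2 fun i j hij => Set.disjoint_left.2 fun x hx hx' => ?_
    exact hx.2 (h.layer_antitone R hij hx'.1)
  · exact fun j => (h.measurableSet_layer j R).diff (h.measurableSet_layer (j + 1) R)

lemma tsum_measure_layer_add_le (h : IsTree S ch) {μ : Measure α} {Λ : ℝ≥0∞}
    (hμ : ∀ R, ∑' j, μ (layer S ch j R) ≤ Λ * μ (S R)) (j : ℕ) (R : ι) :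
    ∑' i, μ (layer S ch (i + j) R) ≤ Λ * μ (layer S ch j R) := by
  induction j generalizing R with
  | zero => exact hμ R
  | succ j ih =>
    simp only [← add_assoc, h.measure_layer_succ]
    rw [ENNReal.tsum_comm, ← ENNReal.tsum_mul_left]
    exact ENNReal.tsum_le_tsum fun R' => ih R'

lemma measurable_layerCount (h : IsTree S ch) (R : ι) : Measurable (layerCount S ch R) :=
  Measurable.tsum fun j => measurable_one.indicator (h.measurableSet_layer j R)

lemma lintegral_layerCount_pow_le (h : IsTree S ch) {μ : Measure α} {Λ : ℝ≥0∞}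
    (hμ : ∀ R, ∑' j, μ (layer S ch j R) ≤ Λ * μ (S R)) (k : ℕ) (R : ι) :
    ∫⁻ x, layerCount S ch R x ^ (k + 1) ∂μ ≤ (k + 1).factorial * (Λ ^ (k + 1) * μ (S R)) := by
  refine (lintegral_mono fun x => pow_sum_indicator_le (h.layer_antitone R) k x).trans ?_
  have hmeas (j : ℕ) := (measurable_one : Measurable (1 : α → ℝ≥0∞)).indicator (h.measurableSet_layer j R)
  rw [lintegral_const_mul _ (Measurable.tsum fun j => (hmeas j).const_mul _),
    lintegral_tsum fun j => ((hmeas j).const_mul _).aemeasurable]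
  gcongr
  simp_rw [lintegral_const_mul _ (hmeas _), lintegral_indicator_one (h.measurableSet_layer _ R)]
  exact tsum_choose_mul_le (a := fun j => μ (layer S ch j R))
    (fun j => h.tsum_measure_layer_add_le hμ j R) k 0

/-- The moments of the counting function of a tree that satisfies a Carleson condition. -/
lemma lintegral_layerCount_rpow_le (h : IsTree S ch) {μ : Measure α} {Λ : ℝ≥0∞}
    (hμ : ∀ R, ∑' j, μ (layer S ch j R) ≤ Λ * μ (S R)) {q : ℝ} (hq : 1 ≤ q) (R : ι) :
    ∫⁻ x in S R, layerCount S ch R x ^ q ∂μ ≤ (ENNReal.ofReal (2 * q) * Λ) ^ q * μ (S R) := by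
  -- The moment of integer order `⌈q⌉` is known; Hölder on `S R` brings it down to order `q`. The
  -- factor `2q` comes from `(k + 1)! ≤ (k + 1) ^ (k + 1)` and `⌈q⌉ ≤ 2q`.
  obtain ⟨k, hk⟩ : ∃ k, ⌈q⌉₊ = k + 1 :=
    Nat.exists_eq_succ_of_ne_zero (Nat.ceil_pos.2 (by linarith)).ne'
  have hq0 : 0 < q := by linarith
  have hqk : q ≤ (k + 1 : ℕ) := hk ▸ Nat.le_ceil q
  have hkq : ((k + 1 : ℕ) : ℝ) ≤ 2 * q := by
    have := Nat.ceil_lt_add_one hq0.le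
    rw [hk] at this
    linarith
  have hk0 : (0 : ℝ) < (k + 1 : ℕ) := hq0.trans_le hqk
  have key := eLpNorm'_le_eLpNorm'_mul_rpow_measure_univ (μ := μ.restrict (S R))
    (f := layerCount S ch R) hq0 hqk (h.measurable_layerCount R).aestronglyMeasurable
  simp only [eLpNorm', enorm_eq_self, Measure.restrict_apply MeasurableSet.univ,
    Set.univ_inter] at key
  have hpow : (∫⁻ x in S R, layerCount S ch R x ^ ((k + 1 : ℕ) : ℝ) ∂μ) ^ (1 / ((k + 1 : ℕ) : ℝ)) ≤
      ENNReal.ofReal (2 * q) * Λ * μ (S R) ^ (1 / ((k + 1 : ℕ) : ℝ)) := by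
    rw [one_div, ENNReal.rpow_inv_le_iff hk0, ENNReal.mul_rpow_of_nonneg _ _ hk0.le,
      ENNReal.rpow_inv_rpow hk0.ne']
    simp_rw [ENNReal.rpow_natCast]
    refine (setLIntegral_le_lintegral _ _).trans ((h.lintegral_layerCount_pow_le hμ k R).trans ?_)
    rw [mul_pow, mul_assoc]
    gcongr
    refine le_trans ?_ (pow_le_pow_left₀ zero_le (ENNReal.ofReal_le_ofReal hkq) _)
    rw [ENNReal.ofReal_natCast]
    exact_mod_cast Nat.factorial_le_pow _
  have hsub : 0 ≤ 1 / q - 1 / ((k + 1 : ℕ) : ℝ) :=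
    sub_nonneg.2 (one_div_le_one_div_of_le hq0 hqk)
  have hfin := key.trans (mul_le_mul_left hpow _)
  rw [mul_assoc, ← ENNReal.rpow_add_of_nonneg _ _ (by positivity) hsub, add_sub_cancel,
    one_div, ENNReal.rpow_inv_le_iff hq0, ENNReal.mul_rpow_of_nonneg _ _ hq0.le,
    ENNReal.rpow_inv_rpow hq0.ne'] at hfin
  exact hfin

end IsTree

end Tree

variable {n : ℕ}

/-! ### Geometry of dyadic cubes. -/

namespace Cube

/-- The dyadic cube of generation `m` and integer position `k` in the grid generated by `R`. -/
noncomputable def sub (R : Cube n) (m : ℕ) (k : Fin n → ℕ) : Cube n where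
  corner := fun i => R.corner i + (k i : ℝ) * (R.side / 2 ^ m)
  side := R.side / 2 ^ m
  side_pos := div_pos R.side_pos (by positivity)

lemma mem_toSet {R : Cube n} {x : Fin n → ℝ} :
    x ∈ R.toSet ↔ ∀ i, R.corner i ≤ x i ∧ x i < R.corner i + R.side := by
  simp [toSet]

lemma measurableSet_toSet (R : Cube n) : MeasurableSet R.toSet :=
  MeasurableSet.univ_pi fun _ => measurableSet_Ico

lemma volume_toSet (R : Cube n) : volume R.toSet = ENNReal.ofReal R.side ^ n := by
  simp [toSet, volume_pi_pi]

lemma volume_toSet_ne_zero (R : Cube n) : volume R.toSet ≠ 0 := by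
  rw [volume_toSet]
  exact pow_ne_zero _ (ENNReal.ofReal_pos.2 R.side_pos).ne'

lemma volume_toSet_ne_top (R : Cube n) : volume R.toSet ≠ ∞ := by
  rw [volume_toSet]
  exact ENNReal.pow_ne_top ENNReal.ofReal_ne_top

lemma mem_dyadic_iff {R R' : Cube n} :
    R' ∈ R.dyadic ↔ ∃ m k, (∀ i, k i < 2 ^ m) ∧ R' = R.sub m k := by
  constructor
  · rintro ⟨m, k, rfl⟩
    exact ⟨m, fun i => k i, fun i => (k i).2, rfl⟩
  · rintro ⟨m, k, hk, rfl⟩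
    exact ⟨m, fun i => ⟨k i, hk i⟩, rfl⟩

lemma sub_zero (R : Cube n) : R.sub 0 0 = R := by
  cases R
  simp [sub]

lemma sub_sub (R : Cube n) (m l : ℕ) (k j : Fin n → ℕ) :
    (R.sub m k).sub l j = R.sub (m + l) fun i => 2 ^ l * k i + j i := by
  simp only [sub, Cube.mk.injEq]
  refine ⟨funext fun i => ?_, ?_⟩
  · push_cast
    field_simp
    ring
  · rw [pow_add, div_div]

lemma sub_subset (R : Cube n) {m : ℕ} {k : Fin n → ℕ} (hk : ∀ i, k i < 2 ^ m) :
    (R.sub m k).toSet ⊆ R.toSet := by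
  intro x hx
  rw [mem_toSet] at hx ⊢
  intro i
  obtain ⟨h1, h2⟩ := hx i
  have hd : 0 < R.side / 2 ^ m := (R.sub m k).side_pos
  have hk' : (k i : ℝ) + 1 ≤ 2 ^ m := by exact_mod_cast hk i
  have hs : 2 ^ m * (R.side / 2 ^ m) = R.side := by field_simp
  simp only [sub] at h1 h2
  constructor
  · have : 0 ≤ (k i : ℝ) * (R.side / 2 ^ m) := by positivity
    linarith
  · nlinarith [mul_le_mul_of_nonneg_right hk' hd.le]

lemma eq_of_mem_sub {R : Cube n} {m : ℕ} {k k' : Fin n → ℕ} {x : Fin n → ℝ}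
    (hx : x ∈ (R.sub m k).toSet) (hx' : x ∈ (R.sub m k').toSet) : k = k' := by
  funext i
  obtain ⟨h1, h2⟩ := mem_toSet.1 hx i
  obtain ⟨h1', h2'⟩ := mem_toSet.1 hx' i
  have hd : 0 < R.side / 2 ^ m := (R.sub m k).side_pos
  simp only [sub] at h1 h2 h1' h2'
  have ha : (k i : ℝ) < k' i + 1 := lt_of_mul_lt_mul_right (by linarith) hd.le
  have hb : (k' i : ℝ) < k i + 1 := lt_of_mul_lt_mul_right (by linarith) hd.le
  norm_cast at ha hb
  omega

/-- Of two dyadic cubes with a common point, the one of later generation is a dyadic descendant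
of the other one. -/
lemma exists_sub_eq_sub_sub {R : Cube n} {m l : ℕ} {k k' : Fin n → ℕ} {x : Fin n → ℝ}
    (hx : x ∈ (R.sub m k).toSet) (hx' : x ∈ (R.sub (m + l) k').toSet) :
    ∃ j : Fin n → ℕ, (∀ i, j i < 2 ^ l) ∧ R.sub (m + l) k' = (R.sub m k).sub l j := by
  have hj (i : Fin n) : k' i % 2 ^ l < 2 ^ l := Nat.mod_lt _ (by positivity)
  have heq : (R.sub m fun i => k' i / 2 ^ l).sub l (fun i => k' i % 2 ^ l) = R.sub (m + l) k' := by
    rw [sub_sub]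
    congr 1
    exact funext fun i => Nat.div_add_mod _ _
  have hk : k = fun i => k' i / 2 ^ l :=
    eq_of_mem_sub hx (sub_subset _ hj (heq ▸ hx'))
  exact ⟨_, hj, by rw [hk, heq]⟩

lemma exists_mem_sub {R : Cube n} {m l : ℕ} {k' : Fin n → ℕ} (hk' : ∀ i, k' i < 2 ^ (m + l)) :
    ∃ k j : Fin n → ℕ, (∀ i, k i < 2 ^ m) ∧ (∀ i, j i < 2 ^ l) ∧
      R.sub (m + l) k' = (R.sub m k).sub l j := by
  refine ⟨fun i => k' i / 2 ^ l, fun i => k' i % 2 ^ l, fun i => ?_,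
    fun i => Nat.mod_lt _ (by positivity), ?_⟩
  · rw [Nat.div_lt_iff_lt_mul (by positivity), ← pow_add]
    exact hk' i
  · rw [sub_sub]
    congr 1
    exact (funext fun i => Nat.div_add_mod _ _).symm

lemma volume_sub_one (R : Cube n) (k : Fin n → ℕ) :
    volume R.toSet = 2 ^ n * volume (R.sub 1 k).toSet := by
  rw [volume_toSet, volume_toSet, ← mul_pow]
  congr 1
  rw [show (2 : ℝ≥0∞) = ENNReal.ofReal 2 by simp, ← ENNReal.ofReal_mul (by norm_num)]
  congr 1
  simp only [sub]
  ring

end Cube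

/-! ### Averages and oscillations over cubes. -/

lemma integrableOn_cube {f : (Fin n → ℝ) → ℝ} (hf : LocallyIntegrable f volume) (R : Cube n) :
    IntegrableOn f R.toSet := by
  refine (hf.integrableOn_isCompact (isCompact_univ_pi fun i =>
    isCompact_Icc (a := R.corner i) (b := R.corner i + R.side))).mono_set ?_
  exact Set.pi_mono fun i _ => Set.Ico_subset_Icc_self

lemma lavg_mul_volume (g : (Fin n → ℝ) → ℝ≥0∞) (R : Cube n) :
    lavg g R * volume R.toSet = ∫⁻ y in R.toSet, g y :=
  ENNReal.div_mul_cancel R.volume_toSet_ne_zero R.volume_toSet_ne_top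

lemma lavg_le_two_pow_mul_lavg (g : (Fin n → ℝ) → ℝ≥0∞) (R : Cube n) {k : Fin n → ℕ}
    (hk : ∀ i, k i < 2 ^ 1) : lavg g (R.sub 1 k) ≤ 2 ^ n * lavg g R := by
  refine ENNReal.div_le_of_le_mul ?_
  rw [mul_right_comm, ← R.volume_sub_one k, mul_comm, lavg_mul_volume]
  exact lintegral_mono_set (R.sub_subset hk)

lemma lavg_enorm_sub_const_le (f : (Fin n → ℝ) → ℝ)
    (R : Cube n) (a b : ℝ) :
    lavg (fun y => ‖f y - b‖ₑ) R ≤ lavg (fun y => ‖f y - a‖ₑ) R + ‖a - b‖ₑ := by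
  refine ENNReal.div_le_of_le_mul ?_
  rw [add_mul, lavg_mul_volume]
  calc ∫⁻ y in R.toSet, ‖f y - b‖ₑ ≤ ∫⁻ y in R.toSet, (‖f y - a‖ₑ + ‖a - b‖ₑ) := by
        refine lintegral_mono fun y => ?_
        rw [← sub_add_sub_cancel (f y) a b]
        exact enorm_add_le _ _
    _ = _ := by
        rw [lintegral_add_right _ measurable_const, setLIntegral_const]

lemma enorm_avg_sub_le {f : (Fin n → ℝ) → ℝ} (hf : LocallyIntegrable f volume)
    (R : Cube n) (a : ℝ) : ‖avg f R - a‖ₑ ≤ lavg (fun y => ‖f y - a‖ₑ) R := by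
  have hint := integrableOn_cube hf R
  have hfin : Fact (volume R.toSet < ∞) := ⟨R.volume_toSet_ne_top.lt_top⟩
  have hne : NeZero (volume.restrict R.toSet) :=
    ⟨by simpa using R.volume_toSet_ne_zero⟩
  have h1 : avg f R - a = ⨍ y in R.toSet, (f y - a) := by
    rw [avg, average, average, integral_sub hint.to_average (integrable_const a),
      integral_const, probReal_univ, one_smul]
  rw [h1, average, lavg, ENNReal.div_eq_inv_mul, ← smul_eq_mul, ← lintegral_smul_measure,
    Measure.restrict_apply_univ]
  exact enorm_integral_le_lintegral_enorm _

lemma osc_ne_top {f : (Fin n → ℝ) → ℝ} (hf : LocallyIntegrable f volume) (R : Cube n) :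
    osc f R ≠ ∞ := by
  refine ENNReal.div_ne_top ?_ R.volume_toSet_ne_zero
  exact ((integrableOn_cube hf R).sub
    (integrableOn_const R.volume_toSet_ne_top)).hasFiniteIntegral.ne

/-! ### The stopping-time tree of `f`. -/

/-- The dyadic cube `P` violates the stopping bound for the oscillation of `f` on `R`. -/
def IsStopping (f : (Fin n → ℝ) → ℝ) (R P : Cube n) : Prop :=
  2 * osc f R < lavg (fun y => ‖f y - avg f R‖ₑ) P

/-- The maximal dyadic descendants of `R` that violate the stopping bound. -/
def stoppingCubes (f : (Fin n → ℝ) → ℝ) (R : Cube n) : Set (Cube n) :=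
  {R' | ∃ m k, (∀ i, k i < 2 ^ m) ∧ R' = R.sub m k ∧ IsStopping f R R' ∧
    ∀ l < m, ∀ j : Fin n → ℕ, (∀ i, j i < 2 ^ l) → R'.toSet ⊆ (R.sub l j).toSet →
      ¬ IsStopping f R (R.sub l j)}

lemma eq_of_mem_stoppingCubes {f : (Fin n → ℝ) → ℝ} {R : Cube n} {m m' : ℕ}
    {k k' : Fin n → ℕ} (hk : ∀ i, k i < 2 ^ m) (hs : IsStopping f R (R.sub m k))
    (hmax : ∀ l < m', ∀ j : Fin n → ℕ, (∀ i, j i < 2 ^ l) →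
      (R.sub m' k').toSet ⊆ (R.sub l j).toSet → ¬ IsStopping f R (R.sub l j))
    {x : Fin n → ℝ} (hx : x ∈ (R.sub m k).toSet) (hx' : x ∈ (R.sub m' k').toSet)
    (hle : m ≤ m') : R.sub m k = R.sub m' k' := by
  rcases hle.eq_or_lt with rfl | hlt
  · rw [Cube.eq_of_mem_sub hx hx']
  · obtain ⟨l, rfl⟩ := Nat.exists_eq_add_of_le hle
    obtain ⟨j, hj, heq⟩ := Cube.exists_sub_eq_sub_sub hx hx'
    exact absurd hs (hmax m hlt k hk (heq ▸ Cube.sub_subset _ hj))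

lemma isTree_stoppingCubes (f : (Fin n → ℝ) → ℝ) :
    IsTree Cube.toSet (stoppingCubes f) where
  measurable := Cube.measurableSet_toSet
  countable R := by
    refine (Set.countable_range fun q : ℕ × (Fin n → ℕ) => R.sub q.1 q.2).mono ?_
    rintro R' ⟨m, k, -, rfl, -⟩
    exact ⟨(m, k), rfl⟩
  subset := by
    rintro R R' ⟨m, k, hk, rfl, -⟩
    exact R.sub_subset hk
  disjoint := by
    rintro R _ ⟨m, k, hk, rfl, hs, hmax⟩ _ ⟨m', k', hk', rfl, hs', hmax'⟩ hne
    refine Set.disjoint_left.2 fun x hx hx' => hne ?_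
    rcases le_total m m' with hle | hle
    · exact eq_of_mem_stoppingCubes hk hs hmax' hx hx' hle
    · exact (eq_of_mem_stoppingCubes hk' hs' hmax hx' hx hle).symm

/-- Chebyshev: the selected cubes are disjoint and the integral of `|f - f_R|` over each exceeds
twice the oscillation times its volume. -/
lemma two_mul_volume_layer_one_le {f : (Fin n → ℝ) → ℝ} (hf : LocallyIntegrable f volume)
    (R : Cube n) :
    2 * volume (layer Cube.toSet (stoppingCubes f) 1 R) ≤ volume R.toSet := by
  have ht := isTree_stoppingCubes f
  have hlt (R') (hR' : R' ∈ stoppingCubes f R) :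
      2 * osc f R < lavg (fun y => ‖f y - avg f R‖ₑ) R' := by
    obtain ⟨m, k, -, -, hs, -⟩ := hR'
    exact hs
  -- A zero oscillation cannot be cancelled, but then the strict inequality in `IsStopping` leaves
  -- no cube to select.
  by_cases h0 : osc f R = 0
  · have hempty : stoppingCubes f R = ∅ := by
      refine Set.eq_empty_of_forall_notMem fun R' hR' => (hlt R' hR').not_ge ?_
      have hR0 : ∫⁻ y in R.toSet, ‖f y - avg f R‖ₑ = 0 := by
        rw [← lavg_mul_volume]
        exact mul_eq_zero_of_left h0 _
      refine (ENNReal.div_le_of_le_mul ?_ : lavg _ R' ≤ 2 * osc f R)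
      exact (lintegral_mono_set (ht.subset R R' hR')).trans (hR0.le.trans zero_le)
    simp [layer, hempty]
  · refine (ENNReal.mul_le_mul_iff_right h0 (osc_ne_top hf R)).1 ?_
    calc osc f R * (2 * volume (layer Cube.toSet (stoppingCubes f) 1 R))
        = ∑' R' : stoppingCubes f R, 2 * osc f R * volume R'.1.toSet := by
          rw [ht.measure_layer_succ, ENNReal.tsum_mul_left, mul_comm 2 (osc f R), mul_assoc]
          rfl
      _ ≤ ∑' R' : stoppingCubes f R, ∫⁻ y in R'.1.toSet, ‖f y - avg f R‖ₑ := by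
          refine ENNReal.tsum_le_tsum fun R' => ?_
          rw [← lavg_mul_volume]
          exact mul_le_mul_left (hlt R'.1 R'.2).le _
      _ = ∫⁻ y in ⋃ R' ∈ stoppingCubes f R, R'.toSet, ‖f y - avg f R‖ₑ :=
          (lintegral_biUnion (ht.countable R) (fun R' _ => ht.measurable R')
            (ht.disjoint R) _).symm
      _ ≤ ∫⁻ y in R.toSet, ‖f y - avg f R‖ₑ :=
          lintegral_mono_set (Set.iUnion₂_subset (ht.subset R))
      _ = osc f R * volume R.toSet := (lavg_mul_volume _ R).symm

lemma volume_le_two_mul_volume_diff_layer_one {f : (Fin n → ℝ) → ℝ}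
    (hf : LocallyIntegrable f volume) (R : Cube n) :
    volume R.toSet ≤ 2 * volume (R.toSet \ layer Cube.toSet (stoppingCubes f) 1 R) := by
  have ht := isTree_stoppingCubes f
  have h2 := two_mul_volume_layer_one_le hf R
  have hadd := measure_sdiff_add_inter (μ := volume) R.toSet (ht.measurableSet_layer 1 R)
  rw [Set.inter_eq_right.2 (ht.layer_subset 1 R)] at hadd
  set a := volume (layer Cube.toSet (stoppingCubes f) 1 R)
  set b := volume (R.toSet \ layer Cube.toSet (stoppingCubes f) 1 R)
  have ha : a ≠ ∞ := fun h => R.volume_toSet_ne_top (by rw [← hadd, h, add_top])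
  rw [← hadd, two_mul] at h2
  have hab : a ≤ b := (ENNReal.add_le_add_iff_right ha).1 h2
  rw [← hadd, two_mul]
  gcongr

/-! ### Pointwise domination by the counting function. -/

lemma osc_le_sharpMaximal (f : (Fin n → ℝ) → ℝ) {R : Cube n} {x : Fin n → ℝ}
    (hx : x ∈ R.toSet) : osc f R ≤ sharpMaximal f x :=
  le_iSup₂ (f := fun (R : Cube n) (_ : x ∈ R.toSet) => osc f R) R hx

lemma one_add_layerCount_le {α ι : Type*} {S : ι → Set α} {ch : ι → Set ι} {R R' : ι}
    (hR' : R' ∈ ch R) {x : α} (hx : x ∈ S R) :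
    1 + layerCount S ch R' x ≤ layerCount S ch R x := by
  rw [layerCount, layerCount, tsum_eq_zero_add' (f := fun j => (layer S ch j R).indicator
    (1 : α → ℝ≥0∞) x) ENNReal.summable]
  refine add_le_add ?_ (ENNReal.tsum_le_tsum fun j => ?_)
  · rw [Set.indicator_of_mem (show x ∈ layer S ch 0 R from hx), Pi.one_apply]
  · exact Set.indicator_le_indicator_of_subset
      (Set.subset_biUnion_of_mem (u := fun R' => layer S ch j R') hR') (fun _ => zero_le) x

lemma one_le_layerCount {α ι : Type*} {S : ι → Set α} {ch : ι → Set ι} {R : ι} {x : α}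
    (hx : x ∈ S R) : 1 ≤ layerCount S ch R x := by
  refine le_trans ?_ (ENNReal.le_tsum 0)
  rw [Set.indicator_of_mem (show x ∈ layer S ch 0 R from hx), Pi.one_apply]

/-- Every stopping cube is contained in a maximal one, on which the average is comparable with
the oscillation on the initial cube. -/
lemma IsStopping.exists_mem_stoppingCubes {f : (Fin n → ℝ) → ℝ} {R : Cube n} {m : ℕ}
    {k : Fin n → ℕ} (hk : ∀ i, k i < 2 ^ m) (hs : IsStopping f R (R.sub m k)) :
    ∃ R' ∈ stoppingCubes f R, (R.sub m k).toSet ⊆ R'.toSet ∧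
      lavg (fun y => ‖f y - avg f R‖ₑ) R' ≤ 2 ^ (n + 1) * osc f R ∧
      ∃ l < m, ∃ j : Fin n → ℕ, (∀ i, j i < 2 ^ l) ∧ R.sub m k = R'.sub l j := by
  classical
  let P : ℕ → Prop := fun m' => ∃ k' : Fin n → ℕ, (∀ i, k' i < 2 ^ m') ∧
    IsStopping f R (R.sub m' k') ∧ (R.sub m k).toSet ⊆ (R.sub m' k').toSet
  have hP : ∃ m', P m' := ⟨m, k, hk, hs, subset_rfl⟩
  obtain ⟨k', hk', hs', hsub⟩ := Nat.find_spec hP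
  have hmin (l) (hl : l < Nat.find hP) := Nat.find_min hP hl
  have hle : Nat.find hP ≤ m := Nat.find_min' hP ⟨k, hk, hs, subset_rfl⟩
  generalize Nat.find hP = m' at *
  have hmem : R.sub m' k' ∈ stoppingCubes f R :=
    ⟨m', k', hk', rfl, hs', fun l hl j hj hsubj hsj => hmin l hl ⟨j, hj, hsj, hsub.trans hsubj⟩⟩
  -- `R` itself never stops, since its average is the oscillation; so the maximal cube has a dyadic
  -- parent within `R`.
  obtain ⟨l, rfl⟩ : ∃ l, m' = l + 1 := by
    refine Nat.exists_eq_succ_of_ne_zero ?_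
    rintro rfl
    have : k' = 0 := funext fun i => by simpa using hk' i
    rw [this, Cube.sub_zero] at hs'
    refine hs'.not_ge ?_
    rw [two_mul]
    exact le_self_add
  obtain ⟨x, hx⟩ : (R.sub m k).toSet.Nonempty :=
    nonempty_of_measure_ne_zero (R.sub m k).volume_toSet_ne_zero
  refine ⟨_, hmem, hsub, ?_, m - (l + 1), by omega, ?_⟩
  -- The parent does not stop, so its average is at most `2 * osc f R`; passing to the child costs
  -- `2 ^ n`.
  · obtain ⟨p, j, hp, hj, heq⟩ := Cube.exists_mem_sub (R := R) hk'
    have hnot : ¬ IsStopping f R (R.sub l p) := fun hsp =>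
      hmin l (Nat.lt_succ_self l) ⟨p, hp, hsp, hsub.trans (heq ▸ Cube.sub_subset _ hj)⟩
    rw [heq, pow_succ, mul_assoc]
    refine (lavg_le_two_pow_mul_lavg _ _ hj).trans ?_
    gcongr
    exact not_lt.1 hnot
  · obtain ⟨l', rfl⟩ := Nat.exists_eq_add_of_le hle
    rw [Nat.add_sub_cancel_left]
    exact Cube.exists_sub_eq_sub_sub (hsub hx) hx

/-- Telescoping along the tree, by induction on the relative generation. A cube that does not stop
is bounded outright. Otherwise it lies in a selected `R'`: replacing `f_R` by `f_{R'}` costs `2 ^ (n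
+ 1) * M^♯ f x`, which is paid for by the generation lost in the count. -/
lemma lavg_sub_le_layerCount {f : (Fin n → ℝ) → ℝ} (hf : LocallyIntegrable f volume)
    {x : Fin n → ℝ} (m : ℕ) (R : Cube n) {k : Fin n → ℕ} (hk : ∀ i, k i < 2 ^ m)
    (hx : x ∈ (R.sub m k).toSet) :
    lavg (fun y => ‖f y - avg f R‖ₑ) (R.sub m k) ≤
      2 ^ (n + 1) * sharpMaximal f x * layerCount Cube.toSet (stoppingCubes f) R x := by
  induction m using Nat.strong_induction_on generalizing R k with
  | _ m ih =>
  have hxR : x ∈ R.toSet := R.sub_subset hk hx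
  have hosc := osc_le_sharpMaximal f hxR
  by_cases hs : IsStopping f R (R.sub m k)
  · obtain ⟨R', hR', hsub, hle, l, hl, j, hj, heq⟩ := hs.exists_mem_stoppingCubes hk
    rw [heq] at hx ⊢
    calc lavg (fun y => ‖f y - avg f R‖ₑ) (R'.sub l j)
        ≤ lavg (fun y => ‖f y - avg f R'‖ₑ) (R'.sub l j) + ‖avg f R' - avg f R‖ₑ :=
          lavg_enorm_sub_const_le f _ _ _
      _ ≤ 2 ^ (n + 1) * sharpMaximal f x * layerCount Cube.toSet (stoppingCubes f) R' x +
            2 ^ (n + 1) * sharpMaximal f x := by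
          refine add_le_add (ih l hl R' hj hx) ?_
          exact (enorm_avg_sub_le hf R' _).trans (hle.trans (by gcongr))
      _ = 2 ^ (n + 1) * sharpMaximal f x *
            (1 + layerCount Cube.toSet (stoppingCubes f) R' x) := by ring
      _ ≤ _ := by
          gcongr
          exact one_add_layerCount_le hR' hxR
  · calc lavg (fun y => ‖f y - avg f R‖ₑ) (R.sub m k)
        ≤ 2 ^ 1 * osc f R * 1 := by simpa [IsStopping] using hs
      _ ≤ _ := by
          gcongr
          · norm_num
          · omega
          · exact one_le_layerCount hxR

/-- The local dyadic maximal function of `f - f_R` is controlled by the sharp maximal function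
and the counting function of the stopping cubes. -/
lemma localDyadicMaximal_le {f : (Fin n → ℝ) → ℝ} (hf : LocallyIntegrable f volume)
    (R : Cube n) (x : Fin n → ℝ) :
    localDyadicMaximal R (fun y => f y - avg f R) x ≤
      2 ^ (n + 1) * sharpMaximal f x * layerCount Cube.toSet (stoppingCubes f) R x := by
  refine iSup_le fun R' => iSup₂_le fun hR' hx => ?_
  obtain ⟨m, k, hk, rfl⟩ := Cube.mem_dyadic_iff.1 hR'
  exact lavg_sub_le_layerCount hf m R hk hx

lemma tsum_volume_layer_le {f : (Fin n → ℝ) → ℝ} (hf : LocallyIntegrable f volume) (R : Cube n) :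
    ∑' j, volume (layer Cube.toSet (stoppingCubes f) j R) ≤ 2 * volume R.toSet := by
  simpa using (isTree_stoppingCubes f).tsum_measure_layer_le (μ := volume)
    (ν := (2 : ℝ≥0∞) • volume) R fun P _ => volume_le_two_mul_volume_diff_layer_one hf P

/-! ### Packing for the measure `w dx`. -/

/-- The measure `w dx`. -/
noncomputable abbrev weightMeasure (w : (Fin n → ℝ) → ℝ) : Measure (Fin n → ℝ) :=
  volume.withDensity fun x => ENNReal.ofReal (w x)

lemma weightMeasure_toSet (w : (Fin n → ℝ) → ℝ) (Q : Cube n) :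
    weightMeasure w Q.toSet = mass w Q :=
  withDensity_apply _ Q.measurableSet_toSet

namespace IsWeight

variable {w : (Fin n → ℝ) → ℝ}

lemma aemeasurable (hw : IsWeight w) : AEMeasurable (fun x => ENNReal.ofReal (w x)) :=
  hw.locallyIntegrable.aestronglyMeasurable.aemeasurable.ennreal_ofReal

lemma mass_ne_top (hw : IsWeight w) (Q : Cube n) : mass w Q ≠ ∞ := by
  have h := (integrableOn_cube hw.locallyIntegrable Q).hasFiniteIntegral.ne
  simp_rw [Real.enorm_of_nonneg (hw.nonneg _)] at h
  exact h

lemma lavg_le_maximal (hw : IsWeight w) {R R' : Cube n} (hR : R'.toSet ⊆ R.toSet)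
    {x : Fin n → ℝ} (hx : x ∈ R'.toSet) :
    lavg (fun y => ENNReal.ofReal (w y)) R' ≤ maximal (R.toSet.indicator w) x := by
  refine le_trans (le_of_eq ?_) (le_iSup₂ (f := fun (S : Cube n) (_ : x ∈ S.toSet) =>
    lavg (fun y => ‖R.toSet.indicator w y‖ₑ) S) R' hx)
  rw [lavg, lavg]
  congr 1
  refine setLIntegral_congr_fun R'.measurableSet_toSet fun y hy => ?_
  simp only [Set.indicator_of_mem (hR hy), Real.enorm_of_nonneg (hw.nonneg y)]

lemma lintegral_maximal_le (hw : IsWeight w) {Q : Cube n} (h0 : mass w Q ≠ 0) :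
    ∫⁻ x in Q.toSet, maximal (Q.toSet.indicator w) x ≤ aInftyConst w * mass w Q := by
  rw [← ENNReal.div_le_iff h0 (hw.mass_ne_top Q)]
  exact le_iSup (fun Q : Cube n =>
    (∫⁻ x in Q.toSet, maximal (Q.toSet.indicator w) x) / mass w Q) Q

/-- Packing is tested against `ν = 2 M(w 1_R) dx`. For a node `R' ⊆ R`, half of its volume avoids
its children, and on that part `M(w 1_R)` is at least the average of `w` over `R'`. The mass `ν(R)`
is what `[w]_{A_∞}` controls. -/
lemma tsum_layer_le (hw : IsWeight w) {f : (Fin n → ℝ) → ℝ} (hf : LocallyIntegrable f volume)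
    (R : Cube n) :
    ∑' j, weightMeasure w (layer Cube.toSet (stoppingCubes f) j R) ≤
      2 * aInftyConst w * weightMeasure w R.toSet := by
  have ht := isTree_stoppingCubes f
  by_cases h0 : weightMeasure w R.toSet = 0
  · simp [h0, measure_mono_null (ht.layer_subset _ R) h0]
  refine (ht.tsum_measure_layer_le (ν := volume.withDensity fun x =>
    2 * maximal (R.toSet.indicator w) x) R fun R' hR' => ?_).trans ?_
  · rw [weightMeasure_toSet, mass, ← lavg_mul_volume,
      withDensity_apply _ (R'.measurableSet_toSet.diff (ht.measurableSet_layer 1 R'))]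
    refine (mul_le_mul_right (volume_le_two_mul_volume_diff_layer_one hf R') _).trans ?_
    rw [← mul_assoc, mul_comm _ (2 : ℝ≥0∞), ← setLIntegral_const]
    refine setLIntegral_mono' (R'.measurableSet_toSet.diff (ht.measurableSet_layer 1 R'))
      fun x hx => ?_
    gcongr
    exact hw.lavg_le_maximal hR' hx.1
  · rw [weightMeasure_toSet] at h0 ⊢
    rw [withDensity_apply _ R.measurableSet_toSet, lintegral_const_mul' _ _ (by simp), mul_assoc]
    gcongr
    exact hw.lintegral_maximal_le h0

end IsWeight

/-! ### The two weighted estimates. -/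

lemma ratioIntegral_le {f : (Fin n → ℝ) → ℝ} (hf : LocallyIntegrable f volume)
    (w : (Fin n → ℝ) → ℝ) (Q : Cube n) {p : ℝ} (hp : 0 ≤ p) :
    ratioIntegral f w Q p ≤ (2 ^ (n + 1)) ^ p *
      ∫⁻ x in Q.toSet, layerCount Cube.toSet (stoppingCubes f) Q x ^ p * ENNReal.ofReal (w x) := by
  rw [← lintegral_const_mul' _ _ (ENNReal.rpow_ne_top_of_nonneg hp (by simp))]
  refine lintegral_mono fun x => ?_
  rw [← mul_assoc, ← ENNReal.mul_rpow_of_nonneg _ _ hp]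
  gcongr
  -- Degenerate quotients are covered: where `M^♯ f = 0` the pointwise bound makes the numerator
  -- vanish, and division by `∞` gives `0`.
  refine ENNReal.div_le_of_le_mul ?_
  rw [mul_right_comm]
  exact localDyadicMaximal_le hf Q x

lemma ratioIntegral_le_massR {f w : (Fin n → ℝ) → ℝ} (hf : LocallyIntegrable f volume)
    (hw : IsWeight w) (Q : Cube n) {p r : ℝ} (hp : 1 ≤ p) (hr : 1 < r) :
    ratioIntegral f w Q p ≤
      (2 ^ (n + 1) * (ENNReal.ofReal (2 * (p * r.conjExponent)) * 2)) ^ p * massR r w Q := by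
  have ht := isTree_stoppingCubes f
  have hrr := Real.HolderConjugate.conjExponent hr
  set r' := r.conjExponent
  have hp0 : 0 ≤ p := by linarith
  have hpr : 1 ≤ p * r' := by nlinarith [hrr.symm.lt]
  have hN := ht.measurable_layerCount Q
  have hN1 : (∫⁻ x in Q.toSet, layerCount Cube.toSet (stoppingCubes f) Q x ^ (p * r')) ^ (1 / r') ≤
      (ENNReal.ofReal (2 * (p * r')) * 2) ^ p * volume Q.toSet ^ (1 / r') := by
    refine (ENNReal.rpow_le_rpow (ht.lintegral_layerCount_rpow_le
      (tsum_volume_layer_le hf) hpr Q) hrr.symm.one_div_nonneg).trans ?_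
    rw [ENNReal.mul_rpow_of_nonneg _ _ hrr.symm.one_div_nonneg, ← ENNReal.rpow_mul,
      mul_assoc p, mul_one_div_cancel hrr.symm.ne_zero, mul_one]
  have hholder := ENNReal.lintegral_mul_le_Lp_mul_Lq (volume.restrict Q.toSet) hrr.symm
    (hN.pow_const p).aemeasurable hw.aemeasurable.restrict
  simp only [Pi.mul_apply, ← ENNReal.rpow_mul] at hholder
  refine (ratioIntegral_le hf w Q hp0).trans ?_
  rw [ENNReal.mul_rpow_of_nonneg _ _ hp0, mul_assoc]
  gcongr
  refine hholder.trans ((mul_le_mul_left hN1 _).trans (le_of_eq ?_))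
  -- The Hölder factors recombine through `|Q|^(1/r') |Q|^(1/r) = |Q|`.
  rw [massR, ← lavg_mul_volume, ENNReal.mul_rpow_of_nonneg _ _ hrr.one_div_nonneg, mul_assoc,
    mul_left_comm (volume Q.toSet ^ (1 / r')), ← ENNReal.rpow_add_of_nonneg _ _
    hrr.symm.one_div_nonneg hrr.one_div_nonneg, hrr.symm.one_div_add_one_div, div_one, ENNReal.rpow_one,
    mul_comm (volume Q.toSet)]

lemma ratioIntegral_le_mass {f w : (Fin n → ℝ) → ℝ} (hf : LocallyIntegrable f volume)
    (hw : IsWeight w) (Q : Cube n) {p : ℝ} (hp : 1 ≤ p) :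
    ratioIntegral f w Q p ≤
      (2 ^ (n + 1) * (ENNReal.ofReal (2 * p) * (2 * aInftyConst w))) ^ p * mass w Q := by
  have ht := isTree_stoppingCubes f
  have hp0 : 0 ≤ p := by linarith
  have hN := (ht.measurable_layerCount Q).pow_const p
  refine (ratioIntegral_le hf w Q hp0).trans ?_
  rw [ENNReal.mul_rpow_of_nonneg _ _ hp0, mul_assoc]
  gcongr
  rw [← weightMeasure_toSet]
  refine le_trans (le_of_eq ?_) (ht.lintegral_layerCount_rpow_le (hw.tsum_layer_le hf) hp Q)
  rw [restrict_withDensity Q.measurableSet_toSet,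
    lintegral_withDensity_eq_lintegral_mul₀ hw.aemeasurable.restrict hN.aemeasurable]
  simp only [Pi.mul_apply, mul_comm]

lemma div_rpow_one_div_le {a b m : ℝ≥0∞} {p : ℝ} (hp : 0 < p) (h : a ≤ b ^ p * m) :
    (a / m) ^ (1 / p) ≤ b := by
  rw [one_div, ENNReal.rpow_inv_le_iff hp]
  exact ENNReal.div_le_of_le_mul h

end SharpJN

theorem theorem1p1 (n : ℕ) (hn : 1 ≤ n) :
    ∃ c : ℝ, 0 < c ∧
      ∀ f : (Fin n → ℝ) → ℝ, LocallyIntegrable f volume →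
      ∀ w : (Fin n → ℝ) → ℝ, SharpJN.IsWeight w →
      ∀ (Q : SharpJN.Cube n) (p : ℝ), 1 ≤ p →
        (∀ r : ℝ, 1 < r →
          (SharpJN.ratioIntegral f w Q p / SharpJN.massR r w Q) ^ (1 / p)
            ≤ ENNReal.ofReal (c * p * Real.conjExponent r)) ∧
        (SharpJN.MemAInfty w →
          (SharpJN.ratioIntegral f w Q p / SharpJN.mass w Q) ^ (1 / p)
            ≤ ENNReal.ofReal (c * p) * SharpJN.aInftyConst w) := by
  have hconst (q : ℝ) : ENNReal.ofReal (2 ^ (n + 1) * 4 * q) =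
      2 ^ (n + 1) * (ENNReal.ofReal (2 * q) * 2) := by
    rw [show (2 : ℝ) ^ (n + 1) * 4 * q = 2 ^ (n + 1) * (2 * q * 2) by ring,
      ENNReal.ofReal_mul (by positivity), ENNReal.ofReal_mul' (by norm_num),
      ENNReal.ofReal_pow (by norm_num), ENNReal.ofReal_ofNat]
  -- `2 ^ (n + 1)` is the cost per generation; the `4` is one `2` from rounding the exponent up to
  -- an integer and one from the children filling at most half of a cube.
  refine ⟨2 ^ (n + 1) * 4, by positivity, fun f hf w hw Q p hp => ⟨fun r hr => ?_, fun _ => ?_⟩⟩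
  · refine SharpJN.div_rpow_one_div_le (by linarith) ?_
    rw [mul_assoc _ p, hconst]
    exact SharpJN.ratioIntegral_le_massR hf hw Q hp hr
  · refine SharpJN.div_rpow_one_div_le (by linarith) ?_
    rw [hconst, mul_assoc, mul_assoc]
    exact SharpJN.ratioIntegral_le_mass hf hw Q hp
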